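/- Let $X$ be a Noetherian scheme and $\mathcal F$ a nonzero coherent sheaf on $X$. A point $x\in X$ is an associated point of a sheaf of $\mathcal O_X$-modules $\mathcal E$ if some element of the stalk $\mathcal E_x$ has annihilator equal to the maximal ideal $\mathfrak m_x$ of $\mathcal O_{X,x}$; write $\mathrm{Ass}(\mathcal E)$ for the set of these points. Assume that $\overline{\{p\}}\cap\overline{\{q\}}=\emptyset$ for all distinct $p,q\in\mathrm{Ass}(\mathcal F)$. Then $\mathrm{Ass}(\mathcal F)$ is finite, say $\mathrm{Ass}(\mathcal F)=\{p_1,\dots,p_n\}$ with the $p_i$ distinct. Let $t_j:\operatorname{Spec}(\mathcal O_{X,p_j})\to X$ be the canonical morphisms and put $$\mathcal F_i=\bigcap_{j\neq i}\ker\bigl(\mathcal F\to t_{j*}t_j^*\mathcal F\bigr)\qquad(1\le i\le n),$$ where $\mathcal F\to t_{j*}t_j^*\mathcal F$ is the adjunction morphism and the empty intersection is $\mathcal F$. Then: 1. $\mathrm{Ass}(\mathcal F_i)=\{p_i\}$ for every $i$. 2. If $0=\mathcal G^0\subseteq\mathcal G^1\subseteq\cdots\subseteq\mathcal G^n=\mathcal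 F$ is a coprimary filtration of $\mathcal F$ with $\mathrm{Ass}(\mathcal G^1)=\{p_i\}$, then $\mathcal F_i=\mathcal G^1$. 3. $\mathcal F=\bigoplus_{i=1}^n\mathcal F_i$; that is, the inclusions $\mathcal F_i\hookrightarrow\mathcal F$ induce an isomorphism $\bigoplus_i\mathcal F_i\to\mathcal F$. Here a coprimary filtration of $\mathcal F$ is a chain of coherent subsheaves $0=\mathcal G^0\subseteq\cdots\subseteq\mathcal G^n=\mathcal F$ such that $\mathrm{Ass}(\mathcal G^k/\mathcal G^{k-1})=\{q_k\}$ for $1\le k\le n$, where $q_1>q_2>\dots>q_n$ lists the elements of $\mathrm{Ass}(\mathcal F)$, each once, in decreasing order for some total order extending the partial order on $\mathrm{Ass}(\mathcal F)$ in which $q<p$ means $\overline{\{p\}}\subsetneq\overline{\{q\}}$. -/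

import Mathlib

open CategoryTheory CategoryTheory.Limits AlgebraicGeometry

universe u

namespace CoprimaryFiltrations

noncomputable section

variable {X : Scheme.{u}}

/-- The stalk `F_x` of a sheaf of modules, as a module over the local ring `𝒪_{X,x}`. -/
instance stalkModule (F : X.Modules) (x : X) :
    Module (X.presheaf.stalk x) (F.presheaf.stalk x) :=
  PresheafOfModules.instModuleCarrierStalkCommRingCatCarrierAbPresheafOpensCarrier
    (R := X.presheaf) F.val x

/-- The scalar action on the stalk is the one induced by the scalar action on sections. -/
theorem stalk_germ_smul (F : X.Modules) (x : X) (U : X.Opens) (hx : x ∈ U)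
    (r : Γ(X, U)) (m : Γ(F, U)) :
    F.presheaf.germ U x hx (r • m) =
      X.presheaf.germ U x hx r • F.presheaf.germ U x hx m :=
  PresheafOfModules.germ_smul (R := X.presheaf) F.val x U hx r m

/-- `x` is an associated point of `F` if some element of the stalk `F_x` has the
maximal ideal of `𝒪_{X,x}` as its annihilator; `Ass F` is the set of these points. -/
def Ass (F : X.Modules) : Set X :=
  {x | ∃ s : F.presheaf.stalk x,
    Ideal.torsionOf (X.presheaf.stalk x) (F.presheaf.stalk x) s =
      IsLocalRing.maximalIdeal (X.presheaf.stalk x)}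

/-- A coherent sheaf (on a locally Noetherian scheme): a quasi-coherent sheaf `F` such that `X` is
covered by affine open subsets `U` for which `Γ(U, F)` is a finitely generated `Γ(U, 𝒪_X)`-module;
for a quasi-coherent `F` the restriction of `F` to such a `U` is the sheaf associated
to the module `Γ(U, F)`. -/
def IsCoherent (F : X.Modules) : Prop :=
  SheafOfModules.IsQuasicoherent.{u} F ∧
    ∀ x : X, ∃ U : X.Opens, x ∈ U ∧ IsAffineOpen U ∧ Module.Finite Γ(X, U) Γ(F, U)

/-- The kernel of the canonical (adjunction unit) morphism `F ⟶ t_* t^* F`, where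
`t : Spec 𝒪_{X,x} ⟶ X` is the canonical morphism. -/
def kerToStalk (F : X.Modules) (x : X) : Subobject F :=
  kernelSubobject
    ((Scheme.Modules.pullbackPushforwardAdjunction (X.fromSpecStalk x)).unit.app F)

/-- The intersection of a family of `𝒪_X`-submodules `K i` of `F`: the kernel of the canonical
morphism `F ⟶ ∏ i, F / K i`. -/
def intersection {F : X.Modules} {ι : Type u} (K : ι → Subobject F) : Subobject F :=
  kernelSubobject (Pi.lift fun i => cokernel.π (K i).arrow)

/-- The intersection, over the associated points `q ≠ p` of `F`, of the kernels of
`F ⟶ t_* t^* F` with `t : Spec 𝒪_{X,q} ⟶ X` the canonical morphism. -/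
def component (F : X.Modules) (p : Ass F) : Subobject F :=
  intersection fun q : {q : Ass F // q ≠ p} => kerToStalk F (q : Ass F)

/-- A coprimary filtration `0 = G^0 ⊆ G^1 ⊆ ⋯ ⊆ G^n = F` of a sheaf `F` on a Noetherian scheme
by coherent subsheaves, with `Ass (G^(i+1) / G^i) = {p_i}` for `i = 0, …, n - 1`. The points
`p_0, …, p_(n-1)` enumerate `Ass F` without repetition in the decreasing order of a total order
that extends the partial order on `Ass F` in which `q < p` means that the closure of `{p}` is
strictly contained in the closure of `{q}`. -/
structure CoprimaryFiltration (F : X.Modules) where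
  /-- the length `n` -/
  length : ℕ
  /-- the subsheaves `G^0, …, G^n` -/
  step : Fin (length + 1) → Subobject F
  /-- the points `p_0, …, p_(n-1)` -/
  point : Fin length → X
  step_mono : Monotone step
  step_zero : step 0 = ⊥
  step_last : step (Fin.last length) = ⊤
  isCoherent : ∀ i, IsCoherent (step i : X.Modules)
  point_injective : Function.Injective point
  range_point : Set.range point = Ass F
  order : ∀ i j, closure {point j} ⊂ closure {point i} → j < i
  ass_quotient : ∀ i : Fin length,
    Ass (cokernel (Subobject.ofLE (step i.castSucc) (step i.succ)
      (step_mono i.castSucc_le_succ))) = {point i}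

end

end CoprimaryFiltrations

/-! Everything is decided on germs. The carrying fact is `IsTildeOnAffines.exists_mem_ass`: a
section with nonzero germ at `x` has nonzero germ at some associated point specializing to `x`. It
reduces to the algebraic `exists_isPrime_torsionOf`.

Since closures of distinct associated points are disjoint, at most one associated point `p`
specializes to a given `x`. If there is none, the stalk `F_x` is zero. The kernel of `F ⟶ t_* t^* F`
at `q` consists of the sections whose germs vanish at all generizations of `q`, so the component at
`p` consists of the sections vanishing at every other associated point. It has zero stalks off the
closure of `p`; as `Ass F` is finite, the other closures can be removed near a point of that
closure, and there the component is all of `F`. This gives the direct sum and the associated points.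

In a filtration starting at `p`, the later quotients have zero stalks on the closure of `p`, so near
that closure sections of `F` already lie in `G^1`. -/

namespace CoprimaryFiltrations

/-! ### Subsheaves, sections and germs -/

section Sections

variable {X : Scheme.{u}} {F G H : X.Modules}

theorem app_injective (f : F ⟶ G) [Mono f] (U : X.Opens) : Function.Injective (f.app U) := by
  have h : Mono ((Scheme.Modules.toPresheaf X).map f) := inferInstance
  have h2 := (NatTrans.mono_iff_mono_app _).1 h (.op U)
  exact (AddCommGrpCat.mono_iff_injective _).1 h2

theorem app_map (f : F ⟶ G) {U V : X.Opens} (i : U ⟶ V) (s : Γ(F, V)) :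
    f.app U (F.presheaf.map i.op s) = G.presheaf.map i.op (f.app V s) :=
  ConcreteCategory.congr_hom (f.mapPresheaf.naturality i.op) s

/-- Sections over `U`, as a functor. -/
noncomputable def sections (U : X.Opens) : X.Modules ⥤ Ab :=
  Scheme.Modules.toPresheaf X ⋙ (evaluation _ _).obj (.op U)

instance (U : X.Opens) : PreservesLimits (sections U) :=
  @comp_preservesLimits _ _ _ _ _ _ _ _ inferInstance (evaluationPreservesLimits (Opposite.op U))

instance (U : X.Opens) : (sections U).Additive where
  map_add {_ _ f g} := Scheme.Modules.Hom.add_app f g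

theorem exists_app_eq_of_exact {S : ShortComplex X.Modules} (hS : S.Exact) [Mono S.f]
    {U : X.Opens} (s : Γ(S.X₂, U)) (hs : S.g.app U s = 0) : ∃ t : Γ(S.X₁, U), S.f.app U t = s := by
  have h := hS.map_of_mono_of_preservesKernel (sections U) inferInstance inferInstance
  exact (ShortComplex.ab_exact_iff _).1 h s hs

theorem exists_app_eq (f : F ⟶ G) [Mono f] {U : X.Opens} (s : Γ(G, U))
    (hs : (cokernel.π f).app U s = 0) : ∃ t : Γ(F, U), f.app U t = s :=
  exists_app_eq_of_exact (S := ShortComplex.mk f (cokernel.π f) (cokernel.condition f))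
    (ShortComplex.exact_cokernel f) s hs

theorem comp_app_apply (f : F ⟶ G) (g : G ⟶ H) {U : X.Opens} (s : Γ(F, U)) :
    (f ≫ g).app U s = g.app U (f.app U s) := rfl

theorem app_cokernel_π (f : F ⟶ G) {U : X.Opens} (t : Γ(F, U)) :
    (cokernel.π f).app U (f.app U t) = 0 := by
  rw [← comp_app_apply, cokernel.condition]; rfl

/-- A section of `F` belongs to a subobject. -/
def IsSection (K : Subobject F) {U : X.Opens} (s : Γ(F, U)) : Prop :=
  ∃ t : Γ((K : X.Modules), U), K.arrow.app U t = s

theorem isSection_iff (K : Subobject F) {U : X.Opens} (s : Γ(F, U)) :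
    IsSection K s ↔ (cokernel.π K.arrow).app U s = 0 :=
  ⟨by rintro ⟨t, rfl⟩; exact app_cokernel_π _ _, exists_app_eq _ _⟩

/-- The hypothesis says that the composite of `K.arrow` with the quotient map of `L` vanishes, so
`K.arrow` lifts through `L`. -/
theorem le_of_isSection {K L : Subobject F}
    (h : ∀ (U : X.Opens) (s : Γ(F, U)), IsSection K s → IsSection L s) : K ≤ L := by
  have h0 : K.arrow ≫ cokernel.π L.arrow = 0 := by
    ext U s
    exact (isSection_iff L _).1 (h U _ ⟨s, rfl⟩)
  refine Subobject.le_of_comm (Abelian.monoLift L.arrow K.arrow h0) (Abelian.monoLift_comp _ _ _)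

theorem isSection_kernelSubobject (f : F ⟶ G) {U : X.Opens} (s : Γ(F, U)) :
    IsSection (kernelSubobject f) s ↔ f.app U s = 0 := by
  constructor
  · rintro ⟨t, rfl⟩
    rw [← comp_app_apply, kernelSubobject_arrow_comp]; rfl
  · intro hs
    obtain ⟨t, rfl⟩ := exists_app_eq_of_exact
      (S := ShortComplex.mk (kernel.ι f) f (kernel.condition f)) (ShortComplex.exact_kernel f) s hs
    exact ⟨(kernelSubobjectIso f).inv.app U t, by
      rw [← comp_app_apply, kernelSubobject_arrow']⟩

theorem isSection_intersection {ι : Type u} (K : ι → Subobject F) {U : X.Opens} (s : Γ(F, U)) :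
    IsSection (intersection K) s ↔ ∀ i, IsSection (K i) s := by
  unfold intersection
  rw [isSection_kernelSubobject]
  simp_rw [isSection_iff]
  constructor
  · intro h i
    rw [← Pi.lift_π (fun i => cokernel.π (K i).arrow) i, comp_app_apply, h, map_zero]
  · intro h
    refine Concrete.isLimit_ext _
      (isLimitOfPreserves (sections U)
        (limit.isLimit (Discrete.functor fun i => cokernel (K i).arrow)))
      _ 0 ?_
    rintro ⟨i⟩
    refine Eq.trans ?_ ((h i).trans (map_zero _).symm)
    rw [← Pi.lift_π (fun i => cokernel.π (K i).arrow) i, comp_app_apply]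
    rfl

theorem germ_app (f : F ⟶ G) {U : X.Opens} (x : X) (hx : x ∈ U) (s : Γ(F, U)) :
    (TopCat.Presheaf.stalkFunctor Ab x).map f.mapPresheaf (F.presheaf.germ U x hx s) =
      G.presheaf.germ U x hx (f.app U s) :=
  TopCat.Presheaf.stalkFunctor_map_germ_apply U x hx f.mapPresheaf s

theorem exists_germ (x : X) (t : F.presheaf.stalk x) :
    ∃ (U : X.Opens) (hx : x ∈ U) (s : Γ(F, U)), F.presheaf.germ U x hx s = t :=
  F.presheaf.exists_germ_eq t

theorem germ_res {U V : X.Opens} (i : U ⟶ V) (x : X) (hx : x ∈ U) (s : Γ(F, V)) :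
    F.presheaf.germ U x hx (F.presheaf.map i.op s) = F.presheaf.germ V x (i.le hx) s :=
  TopCat.Presheaf.germ_res_apply _ i x hx s

theorem exists_map_eq_zero {U : X.Opens} (x : X) (hx : x ∈ U) (s : Γ(F, U))
    (h : F.presheaf.germ U x hx s = 0) :
    ∃ (V : X.Opens) (_ : x ∈ V) (i : V ⟶ U), F.presheaf.map i.op s = 0 := by
  obtain ⟨V, hV, i, j, e⟩ := F.presheaf.germ_eq x hx hx s 0 (by rw [h, map_zero])
  exact ⟨V, hV, i, by rw [e, map_zero]⟩

theorem eq_zero_of_germ {U : X.Opens} (s : Γ(F, U))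
    (h : ∀ (x : X) (hx : x ∈ U), F.presheaf.germ U x hx s = 0) : s = 0 :=
  TopCat.Presheaf.section_ext ⟨_, F.isSheaf⟩ U s 0 fun x hx => by
    rw [map_zero]; exact h x hx

theorem germ_app_eq_zero_iff (f : F ⟶ G) [Mono f] {U : X.Opens} (x : X) (hx : x ∈ U)
    (s : Γ(F, U)) :
    G.presheaf.germ U x hx (f.app U s) = 0 ↔ F.presheaf.germ U x hx s = 0 := by
  constructor
  · intro h
    obtain ⟨V, hV, i, e⟩ := exists_map_eq_zero x hx _ h
    rw [← app_map] at e
    have := app_injective f V (e.trans (map_zero _).symm)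
    rw [← germ_res i x hV, this, map_zero]
  · intro h
    rw [← germ_app, h]
    exact map_zero _

/-- A monomorphism is injective on germs and linear, and a stalk element of the structure sheaf can
be represented by a section near `x`. -/
theorem torsionOf_germ_app (f : F ⟶ G) [Mono f] {U : X.Opens} (x : X) (hx : x ∈ U)
    (s : Γ(F, U)) :
    Ideal.torsionOf (X.presheaf.stalk x) _ (G.presheaf.germ U x hx (f.app U s)) =
      Ideal.torsionOf (X.presheaf.stalk x) _ (F.presheaf.germ U x hx s) := by
  ext r
  obtain ⟨V, hV, a, rfl⟩ := X.presheaf.exists_germ_eq r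
  let W := U ⊓ V
  have hW : x ∈ W := ⟨hx, hV⟩
  let i : W ⟶ U := homOfLE inf_le_left
  let j : W ⟶ V := homOfLE inf_le_right
  rw [Ideal.mem_torsionOf_iff, Ideal.mem_torsionOf_iff, ← germ_res i x hW, ← germ_res i x hW,
    ← X.presheaf.germ_res_apply j x hW, ← stalk_germ_smul, ← stalk_germ_smul, ← app_map,
    ← Scheme.Modules.Hom.app_smul, germ_app_eq_zero_iff]

theorem ass_subset (f : F ⟶ G) [Mono f] : Ass F ⊆ Ass G := by
  rintro x ⟨t, ht⟩
  obtain ⟨U, hx, s, rfl⟩ := exists_germ x t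
  exact ⟨_, (torsionOf_germ_app f x hx s).trans ht⟩

theorem ne_zero_of_torsionOf {x : X} {t : F.presheaf.stalk x}
    (ht : Ideal.torsionOf (X.presheaf.stalk x) (F.presheaf.stalk x) t =
      IsLocalRing.maximalIdeal (X.presheaf.stalk x)) : t ≠ 0 := by
  rintro rfl
  rw [Ideal.torsionOf_zero] at ht
  exact (IsLocalRing.maximalIdeal.isMaximal _).ne_top ht.symm

end Sections

/-! ### The kernel of the adjunction unit in terms of germs -/

section Stalks

section Skyscraper

open IsLocalRing

variable (R : CommRingCat.{u}) [IsLocalRing R] (M : Type u) [AddCommGroup M] [Module R M]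

/-- The value at the closed point of a function on an open subset of the spectrum of a local ring
containing this point. -/
noncomputable def evalClosedPoint (W : (Spec R).Opens) (w : W) (h : (w : Spec R) = closedPoint R) :
    Γ(Spec R, W) →+* R :=
  ((Spec R).presheaf.germ W (closedPoint R) (h ▸ w.2) ≫ (stalkClosedPointIso R).hom).hom

theorem evalClosedPoint_map {V W : (Spec R).Opens} (i : V ⟶ W) (w : V)
    (h : (w : Spec R) = closedPoint R) (r : Γ(Spec R, W)) :
    evalClosedPoint R V w h ((Spec R).presheaf.map i.op r) =
      evalClosedPoint R W ⟨w, i.le w.2⟩ h r := by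
  simp only [evalClosedPoint, CommRingCat.hom_comp, RingHom.comp_apply]
  congr 1
  exact TopCat.Presheaf.germ_res_apply _ i _ _ r

/-- The presheaf of abelian groups of functions supported at the closed point. -/
noncomputable def skyscraperAb : TopCat.Presheaf Ab.{u} (Spec R) where
  -- There is one pair `(w, h)` if `W` contains the closed point and none otherwise: the group is
  -- `M` or zero with no case distinction, and gluing is that of arbitrary functions.
  obj W := AddCommGrpCat.of ((w : W.unop) → PLift ((w : Spec R) = closedPoint R) → M)
  map i := AddCommGrpCat.ofHom
    { toFun := fun f w h => f ⟨w, i.unop.le w.2⟩ h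
      map_zero' := rfl
      map_add' := fun _ _ => rfl }

noncomputable instance (W : ((Spec R).Opens)ᵒᵖ) :
    Module ((Spec R).ringCatSheaf.obj.obj W) ((skyscraperAb R M).obj W) :=
  letI _m (w : W.unop) (h : PLift ((w : Spec R) = closedPoint R)) : Module Γ(Spec R, W.unop) M :=
    Module.compHom M (evalClosedPoint R W.unop w h.down)
  inferInstanceAs (Module Γ(Spec R, W.unop)
    ((w : W.unop) → PLift ((w : Spec R) = closedPoint R) → M))

theorem skyscraperAb_smul (W : (Spec R).Opens) (r : Γ(Spec R, W))
    (f : (w : W) → PLift ((w : Spec R) = closedPoint R) → M) (w : W)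
    (h : PLift ((w : Spec R) = closedPoint R)) :
    (HSMul.hSMul (α := (Spec R).ringCatSheaf.obj.obj (.op W)) (β := (skyscraperAb R M).obj (.op W))
      r f : (skyscraperAb R M).obj (.op W)) w h = evalClosedPoint R W w h.down r • f w h :=
  rfl

/-- The skyscraper sheaf at the closed point of the spectrum of a local ring. -/
noncomputable def skyscraper : (Spec R).Modules where
  val := PresheafOfModules.ofPresheaf (skyscraperAb R M) fun V W i r f => by
    refine funext fun w => funext fun h => ?_
    refine Eq.trans ?_ (skyscraperAb_smul R M W.unop _ _ w h).symm
    exact congrArg (fun a : R => a • ((show (v : V.unop) →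
      PLift ((v : Spec R) = closedPoint R) → M from f) ⟨w, i.unop.le w.2⟩ h))
      (evalClosedPoint_map R i.unop w h.down r).symm
  isSheaf := (TopCat.Presheaf.isSheaf_iff_isSheaf_comp (forget AddCommGrpCat) _).2
    (TopCat.Presheaf.toTypes_isSheaf _
      fun w : Spec R => PLift ((w : Spec R) = closedPoint R) → M)

end Skyscraper

variable {X : Scheme.{u}} (F : X.Modules) (x : X)

variable {F x} in
theorem mem_of_fromSpecStalk {U : X.Opens} (w : (X.fromSpecStalk x) ⁻¹ᵁ U)
    (h : (w : Spec (X.presheaf.stalk x)) = IsLocalRing.closedPoint _) : x ∈ U := by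
  have h1 : X.fromSpecStalk x w ∈ U := w.2
  rwa [h, Scheme.fromSpecStalk_closedPoint] at h1

theorem evalClosedPoint_fromSpecStalk {U : X.Opens} (w : (X.fromSpecStalk x) ⁻¹ᵁ U)
    (h : (w : Spec (X.presheaf.stalk x)) = IsLocalRing.closedPoint _) (r : Γ(X, U)) :
    evalClosedPoint _ _ w h ((X.fromSpecStalk x).app U r) =
      X.presheaf.germ U x (mem_of_fromSpecStalk w h) r := by
  have hx := mem_of_fromSpecStalk w h
  have e : (X.fromSpecStalk x).app U ≫ (Spec (X.presheaf.stalk x)).presheaf.germ _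
      (IsLocalRing.closedPoint _) (h ▸ w.2) ≫ (stalkClosedPointIso _).hom =
        X.presheaf.germ U x hx := by
    rw [Scheme.fromSpecStalk_app hx, Category.assoc, Category.assoc]
    erw [TopCat.Presheaf.germ_res_assoc, germ_stalkClosedPointIso_hom, Iso.inv_hom_id,
      Category.comp_id]
  exact ConcreteCategory.congr_hom e r

/-- A sheaf of modules maps to the direct image of the skyscraper sheaf of its stalk. -/
noncomputable def toSkyscraper : F ⟶ (Scheme.Modules.pushforward (X.fromSpecStalk x)).obj
    (skyscraper (X.presheaf.stalk x) (F.presheaf.stalk x)) where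
  val := PresheafOfModules.homMk
    { app := fun U => AddCommGrpCat.ofHom
        { toFun := fun s w h => F.presheaf.germ U.unop x (mem_of_fromSpecStalk w h.down) s
          map_zero' := funext fun w => funext fun h => map_zero _
          map_add' := fun s t => funext fun w => funext fun h => map_add _ s t }
      naturality := fun V W i => by
        ext s
        refine funext fun w => funext fun h => ?_
        exact germ_res i.unop x (mem_of_fromSpecStalk w h.down) s }
    (fun U r s => by
      refine funext fun w => funext fun h => ?_
      refine (stalk_germ_smul F x U.unop (mem_of_fromSpecStalk w h.down) r s).trans ?_
      exact congrArg (· • _) (evalClosedPoint_fromSpecStalk x w h.down r).symm)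

/-- By adjunction `toSkyscraper` factors through the unit, so it kills `s` too; its value at the
closed point is the germ of `s` at `x`. The pullback never has to be computed. -/
theorem germ_eq_zero_of_unit_app_eq_zero {U : X.Opens} (hx : x ∈ U) (s : Γ(F, U))
    (hs : ((Scheme.Modules.pullbackPushforwardAdjunction (X.fromSpecStalk x)).unit.app F).app U s
      = 0) : F.presheaf.germ U x hx s = 0 := by
  have h := (Adjunction.homEquiv_unit (Scheme.Modules.pullbackPushforwardAdjunction
    (X.fromSpecStalk x)) _ _ _).symm.trans (Equiv.apply_symm_apply
      ((Scheme.Modules.pullbackPushforwardAdjunction (X.fromSpecStalk x)).homEquiv _ _)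
      (toSkyscraper F x))
  have h2 : (toSkyscraper F x).app U s = 0 := by
    rw [← h, comp_app_apply]
    refine (congrArg _ hs).trans (map_zero _)
  let w : (X.fromSpecStalk x) ⁻¹ᵁ U := ⟨IsLocalRing.closedPoint _, by
    change X.fromSpecStalk x (IsLocalRing.closedPoint _) ∈ U
    rwa [Scheme.fromSpecStalk_closedPoint]⟩
  exact congrFun (congrFun h2 w) ⟨rfl⟩

/-- Points of the local spectrum map to generizations of `x`. Near each such image `s` restricts to
zero, hence so does its image under the unit. -/
theorem unit_app_eq_zero_of_germ_eq_zero {U : X.Opens} (s : Γ(F, U))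
    (h : ∀ (y : X) (hy : y ∈ U), y ⤳ x → F.presheaf.germ U y hy s = 0) :
    ((Scheme.Modules.pullbackPushforwardAdjunction (X.fromSpecStalk x)).unit.app F).app U s
      = 0 := by
  set η := (Scheme.Modules.pullbackPushforwardAdjunction (X.fromSpecStalk x)).unit.app F
  refine eq_zero_of_germ (F := (Scheme.Modules.pullback (X.fromSpecStalk x)).obj F)
    (U := (X.fromSpecStalk x) ⁻¹ᵁ U) (η.app U s) fun w hw => ?_
  have hy : X.fromSpecStalk x w ⤳ x := by
    have : X.fromSpecStalk x w ∈ Set.range (X.fromSpecStalk x) := ⟨w, rfl⟩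
    rwa [Scheme.range_fromSpecStalk] at this
  obtain ⟨V, hV, i, e⟩ := exists_map_eq_zero (F := F) (X.fromSpecStalk x w) hw s (h _ hw hy)
  have e2 := (congrArg (η.app V) e).symm.trans (app_map η i s)
  exact (germ_res (F := (Scheme.Modules.pullback (X.fromSpecStalk x)).obj F)
    ((TopologicalSpace.Opens.map (X.fromSpecStalk x).base).map i) w hV (η.app U s)).symm.trans
      ((congrArg _ (e2.symm.trans (map_zero _))).trans (map_zero _))

theorem germ_eq_zero_of_isSection_kerToStalk {U : X.Opens} (hx : x ∈ U) (s : Γ(F, U))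
    (hs : IsSection (kerToStalk F x) s) : F.presheaf.germ U x hx s = 0 :=
  germ_eq_zero_of_unit_app_eq_zero F x hx s ((isSection_kernelSubobject _ s).1 hs)

theorem isSection_kerToStalk_of_germ_eq_zero {U : X.Opens} (s : Γ(F, U))
    (h : ∀ (y : X) (hy : y ∈ U), y ⤳ x → F.presheaf.germ U y hy s = 0) :
    IsSection (kerToStalk F x) s :=
  (isSection_kernelSubobject _ s).2 (unit_app_eq_zero_of_germ_eq_zero F x s h)

end Stalks

/-! ### Quasi-coherent sheaves on affine opens -/

section Quasicoherence

variable {X : Scheme.{u}}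

/-- On every affine open subset `F` is the sheaf associated to its module of sections. -/
def IsTildeOnAffines (F : X.Modules) : Prop :=
  ∀ (U : X.Opens) (hU : IsAffineOpen U), IsIso (F.restrict hU.fromSpec).fromTildeΓ

theorem isTildeOnAffines_of_isQuasicoherent (F : X.Modules)
    (hF : SheafOfModules.IsQuasicoherent.{u} F) : IsTildeOnAffines F := by
  intro U hU
  have : SheafOfModules.IsQuasicoherent.{u} (F.restrict hU.fromSpec) :=
    Scheme.Modules.isQuasicoherent_restrictFunctor hU.fromSpec F
  exact Scheme.Modules.isIso_fromTildeΓ_of_isQuasicoherent (F.restrict hU.fromSpec)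

/-- The tilde functor is fully faithful, and both it and restriction preserve cokernels. This makes
the graded pieces of a filtration accessible. -/
theorem IsTildeOnAffines.cokernel {F G : X.Modules} (hF : IsTildeOnAffines F)
    (hG : IsTildeOnAffines G) (f : F ⟶ G) : IsTildeOnAffines (cokernel f) := by
  intro U hU
  obtain ⟨M, ⟨e⟩⟩ := isIso_fromTildeΓ_iff.1 (hF U hU)
  obtain ⟨N, ⟨e'⟩⟩ := isIso_fromTildeΓ_iff.1 (hG U hU)
  rw [isIso_fromTildeΓ_iff]
  let r := Scheme.Modules.restrictFunctor hU.fromSpec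
  let g := (tilde.functor _).preimage (e.hom ≫ r.map f ≫ e'.inv)
  exact ⟨Limits.cokernel g, ⟨PreservesCokernel.iso (tilde.functor _) g ≪≫
    cokernel.mapIso _ (r.map f) e e' (by
      rw [Functor.map_preimage, Category.assoc, Category.assoc, e'.inv_hom_id,
        Category.comp_id]) ≪≫ (PreservesCokernel.iso r f).symm⟩⟩

theorem map_map {F : X.Modules} {U V W : X.Opens} (i : U ⟶ V) (j : V ⟶ W) (s : Γ(F, W)) :
    F.presheaf.map i.op (F.presheaf.map j.op s) = F.presheaf.map (i ≫ j).op s := by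
  rw [op_comp, Functor.map_comp]; rfl

theorem map_self {F : X.Modules} {U : X.Opens} (i : U ⟶ U) (s : Γ(F, U)) :
    F.presheaf.map i.op s = s := by
  rw [Subsingleton.elim i (𝟙 U), op_id, CategoryTheory.Functor.map_id]; rfl

theorem presheaf_map_map {U V W : X.Opens} (i : U ⟶ V) (j : V ⟶ W) (r : Γ(X, W)) :
    X.presheaf.map i.op (X.presheaf.map j.op r) = X.presheaf.map (i ≫ j).op r := by
  rw [op_comp, Functor.map_comp]; rfl

theorem fromSpec_image_le {U : X.Opens} (hU : IsAffineOpen U) (W : (Spec Γ(X, U)).Opens) :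
    hU.fromSpec ''ᵁ W ≤ U := by
  exact (Scheme.Hom.image_le_opensRange _ _).trans hU.opensRange_fromSpec.le

theorem restrict_fromSpec_smul (F : X.Modules) {U : X.Opens} (hU : IsAffineOpen U)
    (W : (Spec Γ(X, U)).Opens) (r : Γ(X, U)) (s : Γ(F.restrict hU.fromSpec, W)) :
    (F.restrictAppIso hU.fromSpec W).hom (r • s) =
      X.presheaf.map (homOfLE (fromSpec_image_le hU W)).op r •
        (F.restrictAppIso hU.fromSpec W).hom s := by
  rw [Scheme.Modules.smul_Spec_def]
  have h := ConcreteCategory.congr_hom (F.smul_restrictAppIso_hom hU.fromSpec W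
    ((Spec Γ(X, U)).presheaf.map W.leTop.op ((Scheme.ΓSpecIso Γ(X, U)).inv r))) s
  refine h.trans ?_
  have e : (Scheme.ΓSpecIso Γ(X, U)).inv ≫ (Spec Γ(X, U)).presheaf.map W.leTop.op ≫
      (hU.fromSpec.appIso W).inv = X.presheaf.map (homOfLE (fromSpec_image_le hU W)).op := by
    rw [← Category.assoc, Iso.comp_inv_eq, Scheme.Hom.appIso_hom',
      Scheme.Hom.map_appLE, Scheme.Hom.appLE, hU.fromSpec_app_self, Category.assoc,
      ← Functor.map_comp]
    rfl
  exact congrArg (· • (F.restrictAppIso hU.fromSpec W).hom s) (ConcreteCategory.congr_hom e r)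

/-- Sections over `D(f)` are the localization at `f` of those over `U`: this is the surjectivity
half, and `exists_pow_smul_eq_zero` the injectivity half. -/
theorem IsTildeOnAffines.exists_map_eq_pow_smul {F : X.Modules} (hF : IsTildeOnAffines F)
    {U : X.Opens} (hU : IsAffineOpen U) (f : Γ(X, U)) (s : Γ(F, X.basicOpen f)) :
    ∃ (n : ℕ) (t : Γ(F, U)), F.presheaf.map (homOfLE (X.basicOpen_le f)).op t =
      X.presheaf.map (homOfLE (X.basicOpen_le f)).op (f ^ n) • s := by
  have h := (isIso_fromTildeΓ_iff_isLocalizing _).1 (hF U hU) f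
  have e1 := hU.fromSpec_image_basicOpen f
  have e2 : U ≤ hU.fromSpec ''ᵁ ⊤ := by
    rw [Scheme.Hom.image_top_eq_opensRange, hU.opensRange_fromSpec]
  obtain ⟨⟨t, ⟨_, n, rfl⟩⟩, ht⟩ := h.surj (F.presheaf.map (homOfLE e1.le).op s)
  have ht2 : X.presheaf.map
      (homOfLE (fromSpec_image_le hU (PrimeSpectrum.basicOpen f))).op (f ^ n) •
      F.presheaf.map (homOfLE e1.le).op s =
        F.presheaf.map (homOfLE (hU.fromSpec.image_mono le_top)).op
          (show Γ(F, hU.fromSpec ''ᵁ ⊤) from t) :=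
    (restrict_fromSpec_smul F hU _ (f ^ n) (F.presheaf.map (homOfLE e1.le).op s)).symm.trans ht
  refine ⟨n, F.presheaf.map (homOfLE e2).op (show Γ(F, hU.fromSpec ''ᵁ ⊤) from t), ?_⟩
  generalize (show Γ(F, hU.fromSpec ''ᵁ ⊤) from t) = t' at ht2 ⊢
  have ht3 := congrArg (F.presheaf.map (homOfLE e1.ge).op) ht2
  rw [Scheme.Modules.map_smul, map_map, map_map, map_self, presheaf_map_map] at ht3
  rw [map_map]
  exact ht3.symm

theorem IsTildeOnAffines.exists_pow_smul_eq_zero {F : X.Modules} (hF : IsTildeOnAffines F)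
    {U : X.Opens} (hU : IsAffineOpen U) (f : Γ(X, U)) (s : Γ(F, U))
    (hs : F.presheaf.map (homOfLE (X.basicOpen_le f)).op s = 0) : ∃ n : ℕ, f ^ n • s = 0 := by
  have h := (isIso_fromTildeΓ_iff_isLocalizing _).1 (hF U hU) f
  have e1 := hU.fromSpec_image_basicOpen f
  have e2 : U ≤ hU.fromSpec ''ᵁ ⊤ := by
    rw [Scheme.Hom.image_top_eq_opensRange, hU.opensRange_fromSpec]
  have e3 := fromSpec_image_le hU ⊤
  obtain ⟨⟨_, n, rfl⟩, hn⟩ := (IsLocalizedModule.eq_zero_iff (.powers f) _).1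
    (show ((modulesSpecToSheaf.obj (F.restrict hU.fromSpec)).obj.map
      (PrimeSpectrum.basicOpen f).leTop.op).hom (F.presheaf.map (homOfLE e3).op s) = 0 from by
      refine (map_map _ _ s).trans ((map_map (homOfLE e1.le) (homOfLE (X.basicOpen_le f)) s).symm.trans
        ((congrArg _ hs).trans (map_zero _))))
  have hn2 : X.presheaf.map (homOfLE e3).op (f ^ n) • F.presheaf.map (homOfLE e3).op s = 0 :=
    (restrict_fromSpec_smul F hU _ (f ^ n) (F.presheaf.map (homOfLE e3).op s)).symm.trans hn
  rw [← Scheme.Modules.map_smul] at hn2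
  have hn3 := congrArg (F.presheaf.map (homOfLE e2).op) hn2
  rw [map_map, map_self, map_zero] at hn3
  exact ⟨n, hn3⟩

end Quasicoherence

/-! ### Associated points and associated primes -/

section AssociatedPoints

/-- Over a Noetherian ring, an element which is nonzero in the localization at `T` has a multiple
whose annihilator is a prime ideal disjoint from `T`. -/
theorem exists_isPrime_torsionOf {A M : Type*} [CommRing A] [IsNoetherianRing A] [AddCommGroup M]
    [Module A M] (T : Submonoid A) (m : M) (hm : ∀ u ∈ T, u • m ≠ 0) :
    ∃ b : A, (Ideal.torsionOf A M (b • m)).IsPrime ∧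
      ∀ u ∈ T, u ∉ Ideal.torsionOf A M (b • m) := by
  let S : Set (Ideal A) := {I | ∃ b : A, (∀ u ∈ T, u • b • m ≠ 0) ∧ I = Ideal.torsionOf A M (b • m)}
  have hS : S.Nonempty := ⟨_, 1, by simpa using hm, rfl⟩
  obtain ⟨I, ⟨b, hb, rfl⟩, hmax⟩ := set_has_maximal_iff_noetherian.2 ‹IsNoetherianRing A› S hS
  have key : ∀ c : A, (∀ u ∈ T, u • (c * b) • m ≠ 0) →
      Ideal.torsionOf A M ((c * b) • m) = Ideal.torsionOf A M (b • m) := by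
    intro c hc
    by_contra hne
    refine hmax _ ⟨c * b, hc, rfl⟩ (lt_of_le_of_ne ?_ (Ne.symm hne))
    intro a ha
    rw [Ideal.mem_torsionOf_iff] at ha ⊢
    rw [mul_smul, smul_comm, ha, smul_zero]
  refine ⟨b, ⟨?_, ?_⟩, fun u hu h => hb u hu ((Ideal.mem_torsionOf_iff _ _).1 h)⟩
  · intro h
    refine hb 1 T.one_mem ?_
    rw [← Ideal.mem_torsionOf_iff, h]
    trivial
  · intro c d hcd
    -- If `d • b • m` survives, maximality gives it the annihilator of `b • m`, and it is killed by
    -- `c`. Otherwise some `u ∈ T` has `u • d • b • m = 0`; then `d` kills `u • b • m`, which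
    -- survives and so has the same annihilator.
    by_cases hd : ∀ u ∈ T, u • (d * b) • m ≠ 0
    · left
      rw [← key d hd, Ideal.mem_torsionOf_iff]
      rw [Ideal.mem_torsionOf_iff] at hcd
      rw [← mul_smul, ← mul_assoc, mul_smul, hcd]
    · right
      push Not at hd
      obtain ⟨u, hu, hud⟩ := hd
      have hu' : ∀ v ∈ T, v • (u * b) • m ≠ 0 := by
        intro v hv h
        refine hb (v * u) (T.mul_mem hv hu) ?_
        rw [← h]; simp only [mul_smul]
      rw [← key u hu', Ideal.mem_torsionOf_iff, ← hud]
      simp only [← mul_smul]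
      congr 1; ring

variable {X : Scheme.{u}} {F : X.Modules}

theorem smul_germ_eq_zero_iff {x : X} {U : X.Opens} (hx : x ∈ U) {a : Γ(X, U)}
    (ha : x ∈ X.basicOpen a) (t : F.presheaf.stalk x) :
    X.presheaf.germ U x hx a • t = 0 ↔ t = 0 :=
  ((X.mem_basicOpen a x hx).1 ha).smul_eq_zero

theorem IsTildeOnAffines.germ_eq_zero_iff (hF : IsTildeOnAffines F) {U : X.Opens}
    (hU : IsAffineOpen U) {x : X} (hx : x ∈ U) (m : Γ(F, U)) :
    F.presheaf.germ U x hx m = 0 ↔ ∃ a : Γ(X, U), x ∈ X.basicOpen a ∧ a • m = 0 := by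
  constructor
  · intro h
    obtain ⟨V, hV, i, e⟩ := exists_map_eq_zero x hx m h
    obtain ⟨f, hf, hxf⟩ := hU.exists_basicOpen_le ⟨x, hV⟩ hx
    obtain ⟨n, hn⟩ := hF.exists_pow_smul_eq_zero hU f m (by
      rw [Subsingleton.elim (homOfLE (X.basicOpen_le f)) (homOfLE hf ≫ i), ← map_map, e, map_zero])
    refine ⟨f ^ n, ?_, hn⟩
    rw [X.mem_basicOpen _ x hx] at hxf ⊢
    rw [map_pow]
    exact hxf.pow n
  · rintro ⟨a, ha, h⟩
    rw [← smul_germ_eq_zero_iff hx ha, ← stalk_germ_smul, h, map_zero]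

theorem IsTildeOnAffines.exists_germ_smul_eq (hF : IsTildeOnAffines F) {U : X.Opens}
    (hU : IsAffineOpen U) {x : X} (hx : x ∈ U) (t : F.presheaf.stalk x) :
    ∃ (a : Γ(X, U)) (m : Γ(F, U)), x ∈ X.basicOpen a ∧
      X.presheaf.germ U x hx a • t = F.presheaf.germ U x hx m := by
  obtain ⟨V, hV, s, rfl⟩ := exists_germ x t
  obtain ⟨f, hf, hxf⟩ := hU.exists_basicOpen_le ⟨x, hV⟩ hx
  obtain ⟨n, m, e⟩ := hF.exists_map_eq_pow_smul hU f (F.presheaf.map (homOfLE hf).op s)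
  refine ⟨f ^ n, m, ?_, ?_⟩
  · rw [X.mem_basicOpen _ x hx] at hxf ⊢
    rw [map_pow]
    exact hxf.pow n
  · rw [← germ_res (homOfLE (X.basicOpen_le f)) x hxf m, e, stalk_germ_smul, germ_res,
      TopCat.Presheaf.germ_res_apply]

theorem exists_germ_mul_eq {U : X.Opens} (hU : IsAffineOpen U) {x : X} (hx : x ∈ U)
    (r : X.presheaf.stalk x) : ∃ a b : Γ(X, U), x ∈ X.basicOpen a ∧
      X.presheaf.germ U x hx a * r = X.presheaf.germ U x hx b := by
  let := X.presheaf.algebra_section_stalk ⟨x, hx⟩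
  have h := hU.isLocalization_stalk ⟨x, hx⟩
  obtain ⟨⟨b, a⟩, e⟩ := IsLocalization.surj (hU.primeIdealOf ⟨x, hx⟩).asIdeal.primeCompl r
  refine ⟨a, b, (X.mem_basicOpen _ x hx).2 (IsLocalization.map_units (X.presheaf.stalk x) a), ?_⟩
  rw [mul_comm]
  exact e

theorem IsTildeOnAffines.torsionOf_germ_eq_maximalIdeal (hF : IsTildeOnAffines F) {U : X.Opens}
    (hU : IsAffineOpen U) {x : X} (hx : x ∈ U) (m : Γ(F, U))
    (hm : ∀ a : Γ(X, U), a • m = 0 ↔ x ∉ X.basicOpen a) :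
    Ideal.torsionOf (X.presheaf.stalk x) _ (F.presheaf.germ U x hx m) =
      IsLocalRing.maximalIdeal (X.presheaf.stalk x) := by
  ext r
  obtain ⟨a, b, ha, e⟩ := exists_germ_mul_eq hU hx r
  have hu := (X.mem_basicOpen a x hx).1 ha
  have hr : IsUnit r ↔ x ∈ X.basicOpen b := by
    rw [X.mem_basicOpen b x hx, ← e, IsUnit.mul_iff, and_iff_right hu]
  rw [Ideal.mem_torsionOf_iff, ← smul_germ_eq_zero_iff hx ha, ← mul_smul, e, ← stalk_germ_smul,
    hF.germ_eq_zero_iff hU, IsLocalRing.mem_maximalIdeal, mem_nonunits_iff, hr]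
  constructor
  · rintro ⟨c, hc, h⟩ hb
    rw [← mul_smul, hm, X.basicOpen_mul] at h
    exact h ⟨hc, hb⟩
  · intro hb
    refine ⟨1, (X.mem_basicOpen 1 x hx).2 (by rw [map_one]; exact isUnit_one), ?_⟩
    rw [one_smul, hm]
    exact hb

/-- After clearing denominators the annihilating relations hold only in the stalk. The prime of `x`
is finitely generated, so one product of functions invertible at `x` makes all of them hold over
`U`. -/
theorem IsTildeOnAffines.exists_of_mem_ass (hF : IsTildeOnAffines F) {U : X.Opens}
    (hU : IsAffineOpen U) [IsNoetherianRing Γ(X, U)] {x : X} (hx : x ∈ U) (hxF : x ∈ Ass F) :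
    ∃ m : Γ(F, U), ∀ a : Γ(X, U), a • m = 0 ↔ x ∉ X.basicOpen a := by
  obtain ⟨t, ht⟩ := hxF
  obtain ⟨a, m, ha, e⟩ := hF.exists_germ_smul_eq hU hx t
  have hu := (X.mem_basicOpen a x hx).1 ha
  have key : ∀ b : Γ(X, U), F.presheaf.germ U x hx (b • m) = 0 ↔ x ∉ X.basicOpen b := by
    intro b
    rw [stalk_germ_smul, ← e, smul_comm, smul_germ_eq_zero_iff hx ha, ← Ideal.mem_torsionOf_iff,
      ht, IsLocalRing.mem_maximalIdeal, mem_nonunits_iff, X.mem_basicOpen b x hx]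
  obtain ⟨S, hS⟩ := (IsNoetherian.noetherian
    ((IsLocalRing.maximalIdeal (X.presheaf.stalk x)).comap (X.presheaf.germ U x hx).hom))
  have hmem : ∀ b : Γ(X, U), b ∈ Submodule.span Γ(X, U) (S : Set Γ(X, U)) ↔ x ∉ X.basicOpen b := by
    intro b
    rw [hS, X.mem_basicOpen b x hx]
    rfl
  have hc : ∀ b : S, ∃ c : Γ(X, U), x ∈ X.basicOpen c ∧ c • (b : Γ(X, U)) • m = 0 := fun b =>
    (hF.germ_eq_zero_iff hU hx _).1 ((key b).2 ((hmem b).1 (Submodule.subset_span b.2)))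
  choose c hc hcm using hc
  refine ⟨(∏ b, c b) • m, fun b => ?_⟩
  have hprod : x ∈ X.basicOpen (∏ b, c b) := by
    rw [X.mem_basicOpen _ x hx, map_prod, IsUnit.prod_univ_iff]
    exact fun b => (X.mem_basicOpen _ x hx).1 (hc b)
  constructor
  · intro h
    rw [← key, ← smul_germ_eq_zero_iff hx hprod, ← stalk_germ_smul, smul_comm, h, map_zero]
  · intro h
    rw [← hmem] at h
    have hle : Submodule.span Γ(X, U) (S : Set Γ(X, U)) ≤
        Ideal.torsionOf Γ(X, U) Γ(F, U) ((∏ b, c b) • m) := by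
      rw [Submodule.span_le]
      classical
      intro d hd
      rw [SetLike.mem_coe, Ideal.mem_torsionOf_iff, ← Finset.prod_erase_mul _ _
        (Finset.mem_univ (⟨d, hd⟩ : S)), mul_smul, smul_comm, smul_comm d, hcm ⟨d, hd⟩, smul_zero]
    exact (Ideal.mem_torsionOf_iff _ _).1 (hle h)

theorem fromSpec_notMem_basicOpen {U : X.Opens} (hU : IsAffineOpen U)
    (y : PrimeSpectrum Γ(X, U)) (a : Γ(X, U)) :
    hU.fromSpec y ∉ X.basicOpen a ↔ a ∈ y.asIdeal := by
  have h : hU.fromSpec y ∈ X.basicOpen a ↔ a ∉ y.asIdeal := by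
    change (y : Spec Γ(X, U)) ∈ hU.fromSpec ⁻¹ᵁ X.basicOpen a ↔ _
    rw [hU.fromSpec_preimage_basicOpen]
    rfl
  rw [h, not_not]

/-- With `T` the functions invertible at `x`, some multiple of `s` has a prime annihilator disjoint
from `T`. Its point `q` is associated, and disjointness from `T` means `q ⤳ x`. -/
theorem IsTildeOnAffines.exists_mem_ass [IsLocallyNoetherian X] (hF : IsTildeOnAffines F)
    {V : X.Opens} {x : X} (hx : x ∈ V) (s : Γ(F, V)) (hs : F.presheaf.germ V x hx s ≠ 0) :
    ∃ q ∈ Ass F, q ⤳ x ∧ ∃ hq : q ∈ V, F.presheaf.germ V q hq s ≠ 0 := by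
  obtain ⟨_, ⟨U, hU, rfl⟩, hxU, hUV⟩ := X.isBasis_affineOpens.exists_subset_of_mem_open hx V.2
  have hN : IsNoetherianRing Γ(X, U) := IsLocallyNoetherian.component_noetherian ⟨U, hU⟩
  let i : U ⟶ V := homOfLE hUV
  rw [← germ_res i x hxU] at hs
  let T : Submonoid Γ(X, U) :=
    { carrier := {a | x ∈ X.basicOpen a}
      one_mem' := (X.mem_basicOpen 1 x hxU).2 (by rw [map_one]; exact isUnit_one)
      mul_mem' := fun {a b} ha hb => by
        change x ∈ X.basicOpen (a * b)
        rw [X.basicOpen_mul]; exact ⟨ha, hb⟩ }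
  obtain ⟨b, hP, hb⟩ := exists_isPrime_torsionOf T (F.presheaf.map i.op s) fun u hu h =>
    hs ((hF.germ_eq_zero_iff hU hxU _).2 ⟨u, hu, h⟩)
  obtain ⟨q, hqU, hq⟩ : ∃ q ∈ U, ∀ a : Γ(X, U), q ∉ X.basicOpen a ↔
      a ∈ Ideal.torsionOf Γ(X, U) Γ(F, U) (b • F.presheaf.map i.op s) :=
    ⟨hU.fromSpec ⟨_, hP⟩, hU.range_fromSpec.le ⟨_, rfl⟩, fromSpec_notMem_basicOpen hU ⟨_, hP⟩⟩
  have ht := hF.torsionOf_germ_eq_maximalIdeal hU hqU (b • F.presheaf.map i.op s) fun a => by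
    rw [hq, Ideal.mem_torsionOf_iff]
  refine ⟨q, ⟨_, ht⟩, ?_, i.le hqU, fun h => ?_⟩
  · rw [specializes_iff_forall_open]
    intro W hW hxW
    obtain ⟨f, hf, hxf⟩ := hU.exists_basicOpen_le (V := ⟨W, hW⟩) ⟨x, hxW⟩ hxU
    exact hf (not_not.1 fun h => hb f hxf ((hq f).1 h))
  · refine ne_zero_of_torsionOf ht ?_
    rw [stalk_germ_smul, germ_res, h, smul_zero]

/-- Finitely many of the given affine opens cover `X`; on each, associated points come from
associated primes of a finite module over a Noetherian ring. -/
theorem finite_ass [AlgebraicGeometry.IsNoetherian X] (hF : IsCoherent F) : (Ass F).Finite := by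
  have hF' := isTildeOnAffines_of_isQuasicoherent F hF.1
  choose U hxU hU hfin using hF.2
  obtain ⟨S, hS⟩ := CompactSpace.elim_nhds_subcover (fun x => (U x : Set X))
    fun x => (U x).2.mem_nhds (hxU x)
  have key : ∀ x : X, (Ass F ∩ U x).Finite := by
    intro x
    have hN : IsNoetherianRing Γ(X, U x) := IsLocallyNoetherian.component_noetherian ⟨U x, hU x⟩
    have := hfin x
    have h1 : {y : PrimeSpectrum Γ(X, U x) |
        y.asIdeal ∈ associatedPrimes Γ(X, U x) Γ(F, U x)}.Finite :=
      (associatedPrimes.finite _ _).preimage fun a _ b _ h => PrimeSpectrum.ext h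
    refine (h1.image (hU x).fromSpec).subset ?_
    rintro q ⟨hq, hqU⟩
    refine ⟨(hU x).primeIdealOf ⟨q, hqU⟩, ?_, (hU x).fromSpec_primeIdealOf ⟨q, hqU⟩⟩
    obtain ⟨m, hm⟩ := hF'.exists_of_mem_ass (hU x) hqU hq
    refine isAssociatedPrime_iff.2 ⟨((hU x).primeIdealOf ⟨q, hqU⟩).2, m, ?_⟩
    ext a
    rw [Submodule.mem_colon_singleton, Submodule.mem_bot, hm, ← fromSpec_notMem_basicOpen (hU x),
      (hU x).fromSpec_primeIdealOf ⟨q, hqU⟩]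
  refine (S.finite_toSet.biUnion fun x _ => key x).subset fun q hq => ?_
  have : q ∈ ⋃ x ∈ S, (U x : Set X) := by rw [hS]; trivial
  simp only [Set.mem_iUnion] at this ⊢
  obtain ⟨x, hxS, hqx⟩ := this
  exact ⟨x, hxS, hq, hqx⟩

end AssociatedPoints

/-! ### The components and the coprimary filtrations -/

section Components

variable {X : Scheme.{u}} {F : X.Modules}

theorem isSection_component (p : Ass F) {U : X.Opens} (s : Γ(F, U)) :
    IsSection (component F p) s ↔ ∀ q : Ass F, q ≠ p → IsSection (kerToStalk F (q : X)) s := by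
  unfold component
  rw [isSection_intersection, Subtype.forall]

theorem germ_eq_zero_of_isSection_component {p q : X} (hp : p ∈ Ass F) (hq : q ∈ Ass F)
    (hqp : q ≠ p) {U : X.Opens} (hqU : q ∈ U) (s : Γ(F, U))
    (hs : IsSection (component F ⟨p, hp⟩) s) : F.presheaf.germ U q hqU s = 0 :=
  germ_eq_zero_of_isSection_kerToStalk F q hqU s
    ((isSection_component _ s).1 hs ⟨q, hq⟩ fun h => hqp (congrArg Subtype.val h))

variable [IsLocallyNoetherian X] (hF : IsTildeOnAffines F)
  (hd : ∀ p ∈ Ass F, ∀ q ∈ Ass F, ∀ x : X, p ⤳ x → q ⤳ x → p = q)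

include hF in
theorem specializes_of_isSection_component {p x : X} (hp : p ∈ Ass F) {U : X.Opens} (hx : x ∈ U)
    (s : Γ(F, U)) (hs : IsSection (component F ⟨p, hp⟩) s) (h : F.presheaf.germ U x hx s ≠ 0) :
    p ⤳ x := by
  obtain ⟨q, hq, hqx, hqU, hqs⟩ := hF.exists_mem_ass hx s h
  by_cases hqp : q = p
  · exact hqp ▸ hqx
  · exact absurd (germ_eq_zero_of_isSection_component hp hq hqp hqU s hs) hqs

include hF hd in
-- The point `q` may lie outside `U`, so generizations `y` of `q` in `U` are tested. A nonzero germ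
-- at `y` yields an associated point of `U` specializing to `q`, which by disjointness is `q`
-- itself.
theorem isSection_component_of_germ_eq_zero {p : X} (hp : p ∈ Ass F) {U : X.Opens} (s : Γ(F, U))
    (hs : ∀ q ∈ Ass F, q ≠ p → ∀ hq : q ∈ U, F.presheaf.germ U q hq s = 0) :
    IsSection (component F ⟨p, hp⟩) s := by
  refine (isSection_component _ s).2 fun q hqp => ?_
  refine isSection_kerToStalk_of_germ_eq_zero F (q : X) s fun y hy hyq => ?_
  by_contra h
  obtain ⟨q', hq', hqy, hqU, hqs⟩ := hF.exists_mem_ass hy s h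
  have e := hd q' hq' q q.2 q (hqy.trans hyq) specializes_rfl
  exact hqs (hs q' hq' (fun h => hqp (Subtype.ext (e.symm.trans h))) hqU)

include hF hd in
/-- Near a point of the closure of `p`, every section of `F` belongs to the component at `p`. -/
theorem exists_map_isSection_component (hfin : (Ass F).Finite) {p x : X} (hp : p ∈ Ass F)
    (hpx : p ⤳ x) {U : X.Opens} (hx : x ∈ U) (s : Γ(F, U)) :
    ∃ (V : X.Opens) (_ : x ∈ V) (i : V ⟶ U),
      IsSection (component F ⟨p, hp⟩) (F.presheaf.map i.op s) := by
  let Z : Set X := ⋃ q ∈ Ass F \ {p}, closure {q}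
  have hZ : IsClosed Z := (hfin.subset Set.sdiff_subset).isClosed_biUnion fun _ _ => isClosed_closure
  have hxZ : x ∉ Z := by
    simp only [Z, Set.mem_iUnion, not_exists]
    rintro q ⟨hq, hqp⟩ hqx
    exact hqp (hd q hq p hp x (specializes_iff_mem_closure.2 hqx) hpx)
  let V : X.Opens := U ⊓ ⟨Zᶜ, hZ.isOpen_compl⟩
  refine ⟨V, ⟨hx, hxZ⟩, homOfLE inf_le_left,
    isSection_component_of_germ_eq_zero hF hd hp _ fun q hq hqp hqV => ?_⟩
  refine absurd ?_ hqV.2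
  simp only [Z, Set.mem_iUnion]
  exact ⟨q, ⟨hq, hqp⟩, subset_closure rfl⟩

include hF hd in
-- The component has zero stalk at the other associated points of `F`. At `p`, a witness for `p ∈
-- Ass F` belongs to the component after shrinking.
theorem ass_component (hfin : (Ass F).Finite) (p : Ass F) :
    Ass (component F p : X.Modules) = {(p : X)} := by
  obtain ⟨p, hp⟩ := p
  refine Set.Subset.antisymm ?_ (Set.singleton_subset_iff.2 ?_)
  · intro q hqC
    have hq := ass_subset (component F ⟨p, hp⟩).arrow hqC
    obtain ⟨t, ht⟩ := hqC
    obtain ⟨U, hqU, s, rfl⟩ := exists_germ q t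
    by_contra hqp
    refine ne_zero_of_torsionOf ht ((germ_app_eq_zero_iff (component F ⟨p, hp⟩).arrow q hqU s).1 ?_)
    exact germ_eq_zero_of_isSection_component hp hq hqp hqU _ ⟨s, rfl⟩
  · obtain ⟨t, ht⟩ := id hp
    obtain ⟨U, hpU, s, rfl⟩ := exists_germ p t
    obtain ⟨V, hpV, i, c, hc⟩ :=
      exists_map_isSection_component hF hd hfin hp specializes_rfl hpU s
    refine ⟨(component F ⟨p, hp⟩ : X.Modules).presheaf.germ V p hpV c, ?_⟩
    rw [← torsionOf_germ_app (component F ⟨p, hp⟩).arrow, hc, germ_res]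
    exact ht

include hF in
/-- A section of `F` which is nonzero at `x` forces some associated point to specialize to `x`. -/
theorem IsTildeOnAffines.germ_eq_zero_of_forall {x : X} (h : ∀ q ∈ Ass F, ¬ q ⤳ x) {U : X.Opens}
    (hx : x ∈ U) (s : Γ(F, U)) : F.presheaf.germ U x hx s = 0 := by
  by_contra hs
  obtain ⟨q, hq, hqx, -⟩ := hF.exists_mem_ass hx s hs
  exact h q hq hqx

include hF hd in
theorem isIso_sigmaDesc_component (hfin : (Ass F).Finite) :
    IsIso (Sigma.desc fun p : Ass F => (component F p).arrow) := by
  have hepi : Epi (Sigma.desc fun p : Ass F => (component F p).arrow) := by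
    refine Preadditive.epi_of_cancel_zero _ fun {Z} g hg => ?_
    have hg' (p : Ass F) : (component F p).arrow ≫ g = 0 := by
      rw [← Sigma.ι_desc (fun p : Ass F => (component F p).arrow) p, Category.assoc, hg, comp_zero]
    ext U s
    refine eq_zero_of_germ (g.app U s) fun x hx => ?_
    by_cases h : ∃ p ∈ Ass F, p ⤳ x
    · obtain ⟨p, hp, hpx⟩ := h
      obtain ⟨V, hV, i, c, hc⟩ := exists_map_isSection_component hF hd hfin hp hpx hx s
      rw [← germ_res i x hV, ← app_map, ← hc, ← comp_app_apply, hg' ⟨p, hp⟩]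
      exact map_zero _
    · push Not at h
      rw [← germ_app, hF.germ_eq_zero_of_forall h]
      exact map_zero _
  -- At each `x` at most one component has a nonzero germ, so in a vanishing sum every term
  -- vanishes.
  have hmono : Mono (Sigma.desc fun p : Ass F => (component F p).arrow) := by
    have := hfin.fintype
    have := Abelian.hasFiniteBiproducts (C := X.Modules)
    let B := fun p : Ass F => (component F p : X.Modules)
    have e : (biproduct.isoCoproduct B).hom ≫ (Sigma.desc fun p : Ass F => (component F p).arrow) =
        biproduct.desc fun p : Ass F => (component F p).arrow := by
      refine biproduct.hom_ext' _ _ fun p => ?_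
      simp [B]
    rw [← mono_comp_iff_of_isIso (biproduct.isoCoproduct B).hom, e]
    refine Preadditive.mono_of_cancel_zero _ fun {Z} h hh => ?_
    have hsum : ∑ p : Ass F, (h ≫ biproduct.π B p) ≫ (component F p).arrow = 0 := by
      have hB : ∑ p, biproduct.π B p ≫ biproduct.ι B p = 𝟙 (⨁ B) :=
        IsBilimit.total (biproduct.isBilimit B)
      have htot := congrArg (fun f => h ≫ f ≫ biproduct.desc fun p : Ass F => (component F p).arrow)
        hB
      simp only [Preadditive.sum_comp, Preadditive.comp_sum, Category.assoc, Category.id_comp,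
        hh, B, biproduct.ι_desc] at htot
      simpa only [Category.assoc] using htot
    have hzero (p : Ass F) : h ≫ biproduct.π B p = 0 := by
      rw [← cancel_mono (component F p).arrow, zero_comp]
      ext U s
      refine eq_zero_of_germ (F := F) _ fun x hx => ?_
      by_contra hne
      have hpx := specializes_of_isSection_component hF p.2 hx _ ⟨_, rfl⟩ hne
      refine hne ?_
      let Φ : (Z ⟶ F) →+ F.presheaf.stalk x :=
        { toFun := fun f => F.presheaf.germ U x hx (f.app U s)
          map_zero' := map_zero _
          map_add' := fun f g => map_add _ _ _ }
      have hΦ := congrArg Φ hsum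
      rw [map_sum, map_zero, Finset.sum_eq_single p] at hΦ
      · exact hΦ
      · intro q _ hqp
        by_contra hq
        exact hqp (Subtype.ext (hd q q.2 p p.2 x
          (specializes_of_isSection_component hF q.2 hx _ ⟨_, rfl⟩ hq) hpx))
      · exact fun hp => absurd (Finset.mem_univ p) hp
    exact biproduct.hom_ext _ _ fun p => by rw [hzero, zero_comp]
  exact isIso_of_mono_of_epi _

omit [IsLocallyNoetherian X] in
theorem ass_subset_ass_cokernel_ofLE {K L : Subobject F} (h : K ≤ L) (hK : K = ⊥) :
    Ass (L : X.Modules) ⊆ Ass (cokernel (Subobject.ofLE K L h)) := by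
  have h0 : Subobject.ofLE K L h = 0 := by
    subst hK
    rw [← cancel_mono L.arrow, Subobject.ofLE_arrow, Subobject.bot_arrow, zero_comp]
  have : Mono (cokernel.π (Subobject.ofLE K L h)) :=
    (ShortComplex.exact_cokernel (Subobject.ofLE K L h)).mono_g h0
  exact ass_subset (cokernel.π (Subobject.ofLE K L h))

omit [IsLocallyNoetherian X] in
theorem isSection_top {U : X.Opens} (s : Γ(F, U)) : IsSection (⊤ : Subobject F) s :=
  ⟨(inv (⊤ : Subobject F).arrow).app U s, by rw [← comp_app_apply, IsIso.inv_hom_id]; rfl⟩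

include hF hd in
/-- The component of `F` at `p` is the first step of every coprimary filtration of `F` whose first
step is coprimary at `p`. -/
theorem component_eq_step_one (p : Ass F) (G : CoprimaryFiltration F)
    (hG : Ass (G.step 1 : X.Modules) = {(p : X)}) : component F p = G.step 1 := by
  obtain ⟨n, step, point, mono, zero, last, coh, inj, range, order, quot⟩ := G
  dsimp only at hG ⊢
  obtain ⟨p, hp⟩ := p
  obtain ⟨k0, hk0⟩ := range.ge hp
  -- The length is positive because `p` is one of the points. In length zero, the index `1` would
  -- wrap around to `0`.
  obtain ⟨n, rfl⟩ : ∃ m, n = m + 1 := ⟨n - 1, by have := k0.2; omega⟩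
  have hcoh (i : Fin (n + 2)) := isTildeOnAffines_of_isQuasicoherent _ (coh i).1
  have hp0 : p = point 0 :=
    (quot 0).le (ass_subset_ass_cokernel_ofLE (mono (Fin.castSucc_le_succ 0)) zero (hG.ge rfl))
  refine le_antisymm (le_of_isSection fun U s hs => ?_) (le_of_isSection fun U s hs => ?_)
  · rw [isSection_iff]
    refine eq_zero_of_germ _ fun x hx => ?_
    by_cases hsx : F.presheaf.germ U x hx s = 0
    · rw [← germ_app, hsx]
      exact map_zero _
    have hpx := specializes_of_isSection_component hF hp hx s hs hsx
    -- Descending induction from `F` to `G^1`, shrinking the neighbourhood of `x` at each step.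
    have key : ∀ k : Fin (n + 1), ∃ (V : X.Opens) (_ : x ∈ V) (i : V ⟶ U),
        IsSection (step k.succ) (F.presheaf.map i.op s) := by
      intro k
      induction k using Fin.reverseInduction with
      | last =>
        refine ⟨U, hx, 𝟙 U, ?_⟩
        rw [Fin.succ_last, last]
        exact isSection_top _
      | cast k ih =>
        obtain ⟨V, hV, i, c, hc⟩ := ih
        have hle := mono k.succ.castSucc_le_succ
        let ι := Subobject.ofLE _ _ hle
        have hz : (cokernel ι).presheaf.germ V x hV ((cokernel.π ι).app V c) = 0 := by
          -- A nonzero germ in the quotient would make its associated point specialize to `x`, hence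
          -- equal `p = point 0`; but its index is a successor.
          by_contra hne
          obtain ⟨q, hq, hqx, -⟩ := ((hcoh _).cokernel (hcoh _) ι).exists_mem_ass hV _ hne
          have hq' : q = point k.succ := (quot k.succ).le hq
          have hqF : q ∈ Ass F := range.le ⟨_, hq'.symm⟩
          have hqp := hd q hqF p hp x hqx hpx
          exact Fin.succ_ne_zero k (inj (hq'.symm.trans (hqp.trans hp0)))
        obtain ⟨W, hW, j, e⟩ := exists_map_eq_zero x hV _ hz
        rw [← app_map] at e
        obtain ⟨d, hd'⟩ := exists_app_eq ι _ e
        refine ⟨W, hW, j ≫ i, d, ?_⟩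
        rw [← map_map, ← hc, ← app_map, ← hd', ← comp_app_apply, Subobject.ofLE_arrow]
        rfl
    obtain ⟨V, hV, i, h⟩ := key 0
    rw [← germ_res i x hV, ← app_map]
    refine (congrArg _ ((isSection_iff (step 1) _).1 h)).trans (map_zero _)
  · refine isSection_component_of_germ_eq_zero hF hd hp s fun q hq hqp hqU => ?_
    obtain ⟨c, rfl⟩ := hs
    by_contra h
    rw [germ_app_eq_zero_iff] at h
    -- A section of `G^1` with nonzero germ at `q` forces `p ⤳ q`, against disjointness.
    obtain ⟨q', hq', hqq, -⟩ := (hcoh 1).exists_mem_ass hqU c h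
    rw [hG] at hq'
    exact hqp (hd q hq p hp q specializes_rfl ((show q' = p from hq') ▸ hqq))

end Components

end CoprimaryFiltrations

theorem theorem5p1 (X : Scheme.{u}) [AlgebraicGeometry.IsNoetherian X] (F : X.Modules)
    (hcoh : CoprimaryFiltrations.IsCoherent F) (hF : ¬ IsZero F)
    (hdisj : ∀ p ∈ CoprimaryFiltrations.Ass F, ∀ q ∈ CoprimaryFiltrations.Ass F,
      p ≠ q → closure ({p} : Set X) ∩ closure ({q} : Set X) = ∅) :
    -- `F` has only finitely many associated points,
    (CoprimaryFiltrations.Ass F).Finite ∧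
    -- `Ass F_p = {p}`,
    (∀ p : CoprimaryFiltrations.Ass F,
      CoprimaryFiltrations.Ass (CoprimaryFiltrations.component F p : X.Modules) = {(p : X)}) ∧
    -- `F_p = G^1` for every coprimary filtration `G` with `Ass G^1 = {p}`,
    (∀ (p : CoprimaryFiltrations.Ass F) (G : CoprimaryFiltrations.CoprimaryFiltration F),
      CoprimaryFiltrations.Ass (G.step 1 : X.Modules) = {(p : X)} →
        CoprimaryFiltrations.component F p = G.step 1) ∧
    -- and `F` is the internal direct sum of the `F_p`.
    IsIso (Sigma.desc fun p : CoprimaryFiltrations.Ass F =>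
      (CoprimaryFiltrations.component F p).arrow) := by
  have hfin := CoprimaryFiltrations.finite_ass hcoh
  have htilde := CoprimaryFiltrations.isTildeOnAffines_of_isQuasicoherent F hcoh.1
  have hd : ∀ p ∈ CoprimaryFiltrations.Ass F, ∀ q ∈ CoprimaryFiltrations.Ass F, ∀ x : X,
      p ⤳ x → q ⤳ x → p = q := by
    intro p hp q hq x hpx hqx
    by_contra hpq
    exact Set.notMem_empty x (hdisj p hp q hq hpq ▸
      ⟨specializes_iff_mem_closure.1 hpx, specializes_iff_mem_closure.1 hqx⟩)
  exact ⟨hfin, CoprimaryFiltrations.ass_component htilde hd hfin,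
    CoprimaryFiltrations.component_eq_step_one htilde hd,
    CoprimaryFiltrations.isIso_sigmaDesc_component htilde hd hfin⟩
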